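/- For a finite group $G$ let $o(g)$ denote the order of $g\in G$ and put $\rho(G)=\prod_{g\in G}o(g)$. If $\rho(G)=p_1^{\alpha_1}\cdots p_k^{\alpha_k}$ with $p_1,\dots,p_k$ distinct primes and all $\alpha_i\ge 1$, let ${\rm Exp}_\rho(G)=\{\alpha_1,\dots,\alpha_k\}$ be the set of exponents in this factorization. Let $\mathbb{Z}_p$ denote the cyclic group of order $p$. **Theorem.** Let $p>5$ be a prime number. Then ${\rm Exp}_\rho({\rm PSL}(2,5)\times\mathbb{Z}_p)=\{15p,\,20p,\,24p,\,60(p-1)\}$, and for every finite group $G$, $$G\cong {\rm PSL}(2,5)\times\mathbb{Z}_p \quad\text{if and only if}\quad {\rm Exp}_\rho(G)={\rm Exp}_\rho({\rm PSL}(2,5)\times\mathbb{Z}_p).$$ -/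

import Mathlib

/-- The product `ρ(G)` of the orders of all elements of a finite group `G`. -/
noncomputable def prodElementOrders (G : Type*) [Group G] : ℕ :=
  ∏ᶠ g : G, orderOf g

/-- `Exp(n)`: the set of exponents occurring in the prime factorization of `n`. -/
def exponentSet (n : ℕ) : Finset ℕ :=
  n.primeFactors.image fun q => n.factorization q

/-- `Exp_ρ(G)`: the set of exponents in the prime factorization of `ρ(G)`. -/
noncomputable def expRho (G : Type*) [Group G] : Finset ℕ :=
  exponentSet (prodElementOrders G)

/-! The engine is a divisibility of Frobenius type: for primes `r ≠ q`, the full `r`-part of `|G|`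
divides the exponent of `q` in `ρ(G)` (`ordProj_dvd_prodElementOrders_factorization`).

If `Exp_ρ(G)` consists of the four distinct numbers 15p, 20p, 24p, 60(p-1), they occur at four
distinct primes. The part of `|G|` at each of these primes divides the other three values, hence
divides 4, 3, 5, p respectively, and no fifth prime can occur. So the primes are 2, 3, 5, p, and
`|G| = 60p` once a 2-part equal to 2 is excluded by counting.

Since p divides `|G|` exactly once, its exponent counts the elements of order divisible by p. The
value 60(p-1) is the largest possible and forces `N(P) = C(P)` for a Sylow p-subgroup `P`.
Burnside's transfer theorem gives a normal complement `K` of order 60, on which `P` acts trivially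
because p > 5, so `G ≅ K × Z_p`.

Dividing by p, `K` has exponents 15, 20, 24. Their sum 59 is the number of nontrivial elements, so
each of these has prime order. Such a group acts faithfully on its five Sylow 2-subgroups and is the
alternating group of degree 5; PSL(2,5) satisfies the same criterion. -/

/-! ### Frobenius divisibility for `r`-elements and class functions -/

theorem pow_ordProj_eq_one_of_pow_prime_pow {G : Type*} [Group G] [Finite G] {r a m j : ℕ}
    (hG : Nat.card G = r ^ a * m) (hm : r.Coprime m) {x : G}
    (hx : x ^ r ^ j = 1) : x ^ r ^ a = 1 := by
  rw [← orderOf_dvd_iff_pow_eq_one] at hx ⊢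
  have h1 : orderOf x ∣ r ^ a * m := hG ▸ orderOf_dvd_natCard x
  exact (Nat.Coprime.coprime_dvd_left hx (hm.pow_left j)).dvd_of_dvd_mul_right h1

/-- Elements `g` with a prescribed `r'`-part `g ^ k = y` correspond to `r`-elements of the
centralizer of `y`. -/
theorem card_pow_eq_of_pow_eq_one {G : Type*} [Group G] [Finite G] {r a m k : ℕ}
    (hG : Nat.card G = r ^ a * m) (hm : r.Coprime m)
    (hk0 : r ^ a ∣ k) (hk1 : k ≡ 1 [MOD m]) {y : G} (hy : y ^ m = 1) :
    Nat.card {g : G // g ^ k = y} =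
      Nat.card {x : Subgroup.centralizer {y} // ∃ j, x ^ r ^ j = 1} := by
  have hyk : y ^ k = y := by
    conv_rhs => rw [← pow_one y]
    rw [pow_eq_pow_iff_modEq]
    exact hk1.of_dvd (orderOf_dvd_of_pow_eq_one hy)
  -- `g = (g * y⁻¹) * y` splits `g` into commuting `r`- and `r'`-parts; the `r`-part is killed by `r
  -- ^ a`.
  refine Nat.card_congr
    { toFun := fun g => ⟨⟨g.1 * y⁻¹, ?_⟩, a, ?_⟩
      invFun := fun x => ⟨x.1.1 * y, ?_⟩
      left_inv := fun g => ?_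
      right_inv := fun x => ?_ }
  · have hc : Commute g.1 y := by
      conv_rhs => rw [← g.2]
      exact (Commute.refl _).pow_right _
    rw [Subgroup.mem_centralizer_singleton_iff]
    exact (hc.mul_left (Commute.inv_left (Commute.refl y))).eq
  · have hc : Commute g.1 y := by
      conv_rhs => rw [← g.2]
      exact (Commute.refl _).pow_right _
    ext
    simp only [SubmonoidClass.mk_pow, OneMemClass.coe_one]
    rw [hc.inv_right.mul_pow, inv_pow, mul_inv_eq_one]
    conv_rhs => rw [← g.2, ← pow_mul]
    rw [pow_eq_pow_iff_modEq]
    have h := (hk1.mul_right' (r ^ a)).symm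
    rw [one_mul, mul_comm m, ← hG] at h
    exact h.of_dvd (orderOf_dvd_natCard _)
  · obtain ⟨⟨x, hxy⟩, j, hj⟩ := x
    rw [Subgroup.mem_centralizer_singleton_iff] at hxy
    have hj' : x ^ r ^ j = 1 := by simpa [Subtype.ext_iff] using hj
    obtain ⟨c, rfl⟩ := hk0
    simp only
    rw [Commute.mul_pow hxy, hyk, pow_mul,
      pow_ordProj_eq_one_of_pow_prime_pow hG hm hj', one_pow, one_mul]
  · simp
  · simp

theorem card_pow_eq_of_pow_ne_one {G : Type*} [Group G] [Finite G] {r a m k : ℕ}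
    (hG : Nat.card G = r ^ a * m) (hk0 : r ^ a ∣ k) {y : G} (hy : y ^ m ≠ 1) :
    Nat.card {g : G // g ^ k = y} = 0 := by
  rw [Nat.card_eq_zero]
  refine Or.inl ⟨fun g => hy ?_⟩
  rw [← g.2, ← pow_mul]
  obtain ⟨c, rfl⟩ := hk0
  rw [mul_right_comm, ← hG, pow_mul, pow_card_eq_one', one_pow]

theorem card_pow_eq_conj {G : Type*} [Group G] (k : ℕ) (h y : G) :
    Nat.card {g : G // g ^ k = h * y * h⁻¹} = Nat.card {g : G // g ^ k = y} := by
  refine (Nat.card_congr ((MulAut.conj h).toEquiv.subtypeEquiv fun g => ?_)).symm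
  simp [conj_pow]

theorem card_conjClasses_carrier_eq_index {G : Type*} [Group G] (g : G) :
    Nat.card {x : G // ConjClasses.mk x = ConjClasses.mk g} =
      (Subgroup.centralizer {g}).index := by
  rw [Subgroup.centralizer_eq_comap_stabilizer]
  refine Eq.trans ?_ (Subgroup.index_comap_of_surjective (MulAction.stabilizer (ConjAct G) g)
    (f := (ConjAct.toConjAct (G := G)).toMonoidHom) (MulEquiv.surjective _)).symm
  rw [MulAction.index_stabilizer, ConjAct.orbit_eq_carrier_conjClasses,
    ← Nat.card_coe_set_eq]
  exact Nat.card_congr (Equiv.subtypeEquivRight fun x =>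
    ConjClasses.mem_carrier_iff_mk_eq.symm)

/-- Group the sum by conjugacy classes: the class of `g` has as many elements as the index of its
centralizer. -/
theorem dvd_sum_of_conj_invariant {G : Type*} [Group G] [Fintype G] {F : G → ℕ} {d : ℕ}
    (hF : ∀ h g, F (h * g * h⁻¹) = F g)
    (hd : ∀ g, d ∣ (Subgroup.centralizer {g}).index * F g) : d ∣ ∑ g, F g := by
  classical
  rw [← Finset.sum_fiberwise Finset.univ (ConjClasses.mk) F]
  refine Finset.dvd_sum fun c _ => ?_
  induction c using Quotient.inductionOn with | h a => ?_
  change d ∣ ∑ i with ConjClasses.mk i = ConjClasses.mk a, F i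
  have h1 : ∀ i ∈ Finset.univ.filter (fun i => ConjClasses.mk i = ConjClasses.mk a),
      F i = F a := by
    intro i hi
    rw [Finset.mem_filter, ConjClasses.mk_eq_mk_iff_isConj, isConj_comm, isConj_iff] at hi
    obtain ⟨-, c, rfl⟩ := hi
    exact hF c a
  rw [Finset.sum_congr rfl h1, Finset.sum_const, smul_eq_mul, ← Fintype.card_subtype,
    ← Nat.card_eq_fintype_card, card_conjClasses_carrier_eq_index]
  exact hd a

theorem ordProj_mul_dvd_mul {r i c t : ℕ} (hc : c ≠ 0)
    (ht : r ^ c.factorization r ∣ t) :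
    r ^ (i * c).factorization r ∣ i * t := by
  rcases eq_or_ne i 0 with rfl | hi
  · simp
  rw [Nat.factorization_mul hi hc, Finsupp.add_apply, pow_add]
  exact mul_dvd_mul (Nat.ordProj_dvd _ _) ht

/-- By the Chinese remainder theorem there is a `k` for which `g ↦ g ^ k` extracts the `r'`-part of
every element. -/
theorem exists_coprime_part_exponent {r : ℕ} (hr : r.Prime) {n : ℕ} (hn : n ≠ 0) :
    ∃ a m k, n = r ^ a * m ∧ r.Coprime m ∧ r ^ a ∣ k ∧
      k ≡ 1 [MOD m] := by
  have hco : (r ^ n.factorization r).Coprime (n / r ^ n.factorization r) :=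
    (Nat.coprime_ordCompl hr hn).pow_left _
  obtain ⟨k, hk0, hk1⟩ := Nat.chineseRemainder hco 0 1
  exact ⟨_, _, k, (Nat.ordProj_mul_ordCompl_eq_self n r).symm, Nat.coprime_ordCompl hr hn,
    (Nat.modEq_zero_iff_dvd).1 hk0, hk1⟩

theorem sum_comp_pow {G : Type*} [Group G] [Fintype G] (k : ℕ) (f : G → ℕ) :
    ∑ g, f (g ^ k) = ∑ y, Nat.card {g : G // g ^ k = y} * f y := by
  classical
  rw [← Finset.sum_fiberwise Finset.univ (fun g : G => g ^ k)]
  refine Finset.sum_congr rfl fun y _ => ?_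
  rw [Finset.sum_congr rfl (g := fun _ => f y), Finset.sum_const, smul_eq_mul,
    ← Fintype.card_subtype, ← Nat.card_eq_fintype_card]
  intro x hx
  rw [(Finset.mem_filter.1 hx).2]

/-- These elements form a subgroup, as the center is abelian; by Cauchy, `r` dividing its order
would give an element of order `r` killed by `m`. -/
theorem coprime_card_center_pow_ker {G : Type*} [Group G] [Finite G] {r m : ℕ} (hr : r.Prime)
    (hm : r.Coprime m) :
    r.Coprime (Nat.card {z : Subgroup.center G // z ^ m = 1}) := by
  have : Fact r.Prime := ⟨hr⟩
  rw [hr.coprime_iff_not_dvd]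
  intro h
  let S : Subgroup (Subgroup.center G) :=
    { carrier := {z | z ^ m = 1}
      one_mem' := one_pow m
      mul_mem' := fun {x y} hx hy => by
        have hc : Commute x y := Subtype.ext (Subgroup.mem_center_iff.1 y.2 x)
        rw [Set.mem_ofPred_eq] at hx hy ⊢
        rw [hc.mul_pow, hx, hy, one_mul]
      inv_mem' := fun {x} hx => by
        rw [Set.mem_ofPred_eq] at hx ⊢
        rw [inv_pow, hx, inv_one] }
  change r ∣ Nat.card S at h
  obtain ⟨z, hzr⟩ := exists_prime_orderOf_dvd_card' r h
  rw [← Subgroup.orderOf_coe] at hzr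
  have hz : r ∣ m := hzr ▸ orderOf_dvd_of_pow_eq_one z.2
  exact hr.one_lt.ne' (hm.eq_one_of_dvd hz)

/-- Frobenius: the order of a Sylow `r`-subgroup divides the number of `r`-elements. -/
theorem ordProj_dvd_card_primary_elements {r : ℕ} (hr : r.Prime) (G : Type*) [Group G]
    [Finite G] :
    r ^ (Nat.card G).factorization r ∣ Nat.card {x : G // ∃ j, x ^ r ^ j = 1} := by
  induction hn : Nat.card G using Nat.strong_induction_on generalizing G with | h n ih => ?_
  subst hn
  classical
  have := Fintype.ofFinite G
  obtain ⟨a, m, k, hG, hm, hk0, hk1⟩ := exists_coprime_part_exponent hr (Nat.card_pos (α := G)).ne'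
  let Z : Finset G := Finset.univ.filter fun y => y ∈ Subgroup.center G ∧ y ^ m = 1
  have hsum : Nat.card G = ∑ y, Nat.card {g : G // g ^ k = y} := by
    have := sum_comp_pow k (fun _ : G => 1)
    simpa using this
  -- Central `y` are set aside: the induction hypothesis applies only to proper centralizers.
  let F : G → ℕ := fun y =>
    if y ∈ Subgroup.center G then 0 else Nat.card {g : G // g ^ k = y}
  have hF : r ^ (Nat.card G).factorization r ∣ ∑ y, F y := by
    refine dvd_sum_of_conj_invariant (fun h g => ?_) fun y => ?_
    · have : h * g * h⁻¹ ∈ Subgroup.center G ↔ g ∈ Subgroup.center G :=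
        ⟨fun hc => by
          have := Subgroup.Normal.conj_mem inferInstance _ hc h⁻¹
          simpa [mul_assoc] using this, fun hc => Subgroup.Normal.conj_mem inferInstance _ hc h⟩
      simp only [F, this, card_pow_eq_conj]
    · by_cases hyc : y ∈ Subgroup.center G
      · simp [F, hyc]
      simp only [F, hyc, if_false]
      by_cases hy : y ^ m = 1
      · rw [card_pow_eq_of_pow_eq_one hG hm hk0 hk1 hy,
          ← Subgroup.index_mul_card (Subgroup.centralizer {y})]
        refine ordProj_mul_dvd_mul Nat.card_pos.ne' (ih _ ?_ _ rfl)
        refine lt_of_le_of_ne (Subgroup.card_le_card_group _) fun h => hyc ?_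
        have htop := Subgroup.eq_top_of_card_eq _ h
        rw [Subgroup.mem_center_iff]
        intro g
        have : g ∈ Subgroup.centralizer {y} := htop ▸ Subgroup.mem_top g
        exact Subgroup.mem_centralizer_singleton_iff.1 this
      · rw [card_pow_eq_of_pow_ne_one hG hk0 hy, mul_zero]
        exact dvd_zero _
  -- Each central `y` with `y ^ m = 1` contributes the number of `r`-elements of `G` itself. The
  -- number of such `y` is prime to `r`, so it can be cancelled.
  have hsplit : Nat.card G =
      Nat.card {z : Subgroup.center G // z ^ m = 1} * Nat.card {x : G // ∃ j, x ^ r ^ j = 1} +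
        ∑ y, F y := by
    have hZ : Z.card = Nat.card {z : Subgroup.center G // z ^ m = 1} := by
      rw [← Fintype.card_subtype, ← Nat.card_eq_fintype_card]
      exact Nat.card_congr
        { toFun := fun y => ⟨⟨y.1, y.2.1⟩, Subtype.ext y.2.2⟩
          invFun := fun z => ⟨z.1.1, z.1.2, congrArg Subtype.val z.2⟩
          left_inv := fun _ => rfl
          right_inv := fun _ => rfl }
    rw [← hZ, ← smul_eq_mul, ← Finset.sum_const, Finset.sum_filter, ← Finset.sum_add_distrib,
      hsum]
    refine Finset.sum_congr rfl fun y _ => ?_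
    by_cases hyc : y ∈ Subgroup.center G
    · by_cases hy : y ^ m = 1
      · simp only [F, hyc, hy, and_self, if_true, add_zero]
        rw [card_pow_eq_of_pow_eq_one hG hm hk0 hk1 hy]
        have htop : Subgroup.centralizer {y} = ⊤ := by
          rw [eq_top_iff]
          intro g _
          exact Subgroup.mem_centralizer_singleton_iff.2 (Subgroup.mem_center_iff.1 hyc g)
        rw [htop]
        exact Nat.card_congr (Subgroup.topEquiv.toEquiv.subtypeEquiv fun x => by
          simp [Subtype.ext_iff])
      · rw [card_pow_eq_of_pow_ne_one hG hk0 hy]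
        simp [F, hyc, hy]
    · simp [F, hyc]
  have h1 := Nat.ordProj_dvd (Nat.card G) r
  conv at h1 => rhs; rw [hsplit]
  rw [Nat.dvd_add_left hF] at h1
  exact (Nat.Coprime.pow_left _ (coprime_card_center_pow_ker hr hm)).dvd_of_dvd_mul_left h1

/-- As `f` depends only on the `r'`-part `y`, the class of `y` contributes a multiple of its size
times the number of `r`-elements of `C(y)`; Frobenius applies in `C(y)`. -/
theorem ordProj_dvd_sum_of_conj_invariant {G : Type*} [Group G] [Fintype G] {r a m k : ℕ}
    (hr : r.Prime) (hG : Nat.card G = r ^ a * m) (hm : r.Coprime m)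
    (hk0 : r ^ a ∣ k) (hk1 : k ≡ 1 [MOD m]) {f : G → ℕ}
    (hf : ∀ h g, f (h * g * h⁻¹) = f g) (hfk : ∀ g, f (g ^ k) = f g) :
    r ^ (Nat.card G).factorization r ∣ ∑ g, f g := by
  rw [← Finset.sum_congr rfl fun g _ => hfk g, sum_comp_pow]
  refine dvd_sum_of_conj_invariant (fun h g => by rw [card_pow_eq_conj, hf]) fun y => ?_
  by_cases hy : y ^ m = 1
  · rw [card_pow_eq_of_pow_eq_one hG hm hk0 hk1 hy, ← mul_assoc,
      ← Subgroup.index_mul_card (Subgroup.centralizer {y})]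
    exact (ordProj_mul_dvd_mul Nat.card_pos.ne'
      (ordProj_dvd_card_primary_elements hr _)).mul_right _
  · rw [card_pow_eq_of_pow_ne_one hG hk0 hy, zero_mul, mul_zero]
    exact dvd_zero _

/-! ### Exponents of `ρ(G)` -/

theorem prodElementOrders_eq_prod (G : Type*) [Group G] [Fintype G] :
    prodElementOrders G = ∏ g : G, orderOf g := finprod_eq_prod_of_fintype _

theorem prodElementOrders_factorization (G : Type*) [Group G] [Fintype G] (q : ℕ) :
    (prodElementOrders G).factorization q = ∑ g : G, (orderOf g).factorization q := by
  rw [prodElementOrders_eq_prod, Nat.factorization_prod fun g _ => (orderOf_pos g).ne',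
    Finset.sum_apply']

theorem factorization_orderOf_pow_eq {G : Type*} [Group G] [Finite G] {q k : ℕ} {g : G}
    (h : ¬ q ∣ (orderOf g).gcd k) :
    (orderOf (g ^ k)).factorization q = (orderOf g).factorization q := by
  rw [orderOf_pow, Nat.factorization_div (Nat.gcd_dvd_left _ _), Finsupp.coe_tsub, Pi.sub_apply,
    Nat.factorization_eq_zero_of_not_dvd h, Nat.sub_zero]

/-- The exponent of `q` in `o(g)` is a class function unchanged when `g` is replaced by its
`r'`-part. -/
theorem ordProj_dvd_prodElementOrders_factorization (G : Type*) [Group G] [Finite G] {r q : ℕ}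
    (hr : r.Prime) (hq : q.Prime) (hrq : r ≠ q) :
    r ^ (Nat.card G).factorization r ∣ (prodElementOrders G).factorization q := by
  have := Fintype.ofFinite G
  obtain ⟨a, m, k, hG, hm, hk0, hk1⟩ := exists_coprime_part_exponent hr (Nat.card_pos (α := G)).ne'
  rw [prodElementOrders_factorization]
  refine ordProj_dvd_sum_of_conj_invariant hr hG hm hk0 hk1 (fun h g => ?_) fun g => ?_
  · rw [← MulAut.conj_apply, MulEquiv.orderOf_eq]
  · refine factorization_orderOf_pow_eq fun hdvd => ?_
    have h1 : q ∣ m := by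
      have : q ∣ r ^ a * m := hG ▸ ((hdvd.trans (Nat.gcd_dvd_left _ _)).trans
        (orderOf_dvd_natCard g))
      exact ((hq.dvd_mul.1 this).resolve_left fun h =>
        hrq ((Nat.prime_dvd_prime_iff_eq hq hr).1 (hq.dvd_of_dvd_pow h)).symm)
    have h2 := hk1.of_dvd h1
    have h3 : k ≡ 0 [MOD q] := Nat.modEq_zero_iff_dvd.2 (hdvd.trans (Nat.gcd_dvd_right _ _))
    have h4 := (Nat.modEq_zero_iff_dvd.1 (h2.symm.trans h3))
    exact hq.one_lt.ne' (Nat.dvd_one.1 h4)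

/-! ### Order 60: prime element orders and the exponents 15, 20, 24 -/

theorem cardFactors_eq_of_dvd_sixty {d : ℕ} (hd : d ∣ 60) :
    ArithmeticFunction.cardFactors d =
      d.factorization 2 + d.factorization 3 + d.factorization 5 := by
  rw [ArithmeticFunction.cardFactors_eq_sum_factorization,
    Finsupp.sum_of_support_subset (s := {2, 3, 5}) _ _ _ (fun _ _ => rfl)]
  · simp [add_assoc]
  · rw [Nat.support_factorization]
    refine (Nat.primeFactors_mono hd (by norm_num)).trans ?_
    rw [show 60 = 2 ^ 2 * 3 * 5 by norm_num, Nat.primeFactors_mul (by norm_num) (by norm_num),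
      Nat.primeFactors_mul (by norm_num) (by norm_num), Nat.primeFactors_prime_pow (by norm_num)
      Nat.prime_two, Nat.prime_three.primeFactors, Nat.prime_five.primeFactors]
    decide

theorem sum_cardFactors_orderOf {K : Type*} [Group K] [Fintype K] (hK : Nat.card K = 60) :
    ∑ x : K, ArithmeticFunction.cardFactors (orderOf x) =
      (prodElementOrders K).factorization 2 + (prodElementOrders K).factorization 3 +
        (prodElementOrders K).factorization 5 := by
  simp only [prodElementOrders_factorization]
  rw [← Finset.sum_add_distrib, ← Finset.sum_add_distrib]
  exact Finset.sum_congr rfl fun x _ =>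
    cardFactors_eq_of_dvd_sixty (hK ▸ orderOf_dvd_natCard x)

/-- Each of the 59 nontrivial orders has at least one prime factor, and 15 + 20 + 24 = 59 leaves
room for only one each. -/
theorem orderOf_prime_of_factorizations {K : Type*} [Group K] [Finite K]
    (hK : Nat.card K = 60) (h2 : (prodElementOrders K).factorization 2 = 15)
    (h3 : (prodElementOrders K).factorization 3 = 20)
    (h5 : (prodElementOrders K).factorization 5 = 24) {x : K} (hx : x ≠ 1) :
    (orderOf x).Prime := by
  classical
  have := Fintype.ofFinite K
  rw [← ArithmeticFunction.cardFactors_eq_one_iff_prime]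
  have hs := sum_cardFactors_orderOf hK
  rw [h2, h3, h5] at hs
  have hcard : (Finset.univ.erase (1 : K)).card = 59 := by
    rw [Finset.card_erase_of_mem (Finset.mem_univ _), Finset.card_univ,
      ← Nat.card_eq_fintype_card, hK]
  have hle : ∀ y ∈ Finset.univ.erase (1 : K),
      1 ≤ ArithmeticFunction.cardFactors (orderOf y) := by
    intro y hy
    rw [Nat.one_le_iff_ne_zero, ne_eq, ArithmeticFunction.cardFactors_eq_zero_iff_eq_zero_or_one,
      orderOf_eq_one_iff]
    exact fun h => h.elim (orderOf_pos y).ne' (Finset.ne_of_mem_erase hy)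
  have hs' : ∑ y ∈ Finset.univ.erase (1 : K), 1 =
      ∑ y ∈ Finset.univ.erase (1 : K), ArithmeticFunction.cardFactors (orderOf y) := by
    rw [Finset.sum_const, hcard, Finset.sum_erase _ (by simp), hs]
    rfl
  exact ((Finset.sum_eq_sum_iff_of_le hle).1 hs' x
    (Finset.mem_erase.2 ⟨hx, Finset.mem_univ _⟩)).symm

theorem factorization_prodElementOrders_pos {K : Type*} [Group K] [Finite K] {q : ℕ}
    (hq : q.Prime) (h : q ∣ Nat.card K) : 0 < (prodElementOrders K).factorization q := by
  have := Fintype.ofFinite K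
  have := Fact.mk hq
  obtain ⟨x, hx⟩ := exists_prime_orderOf_dvd_card' q h
  rw [prodElementOrders_factorization]
  refine lt_of_lt_of_le ?_ (Finset.single_le_sum (fun _ _ => Nat.zero_le _) (Finset.mem_univ x))
  rw [hx, hq.factorization_self]
  exact one_pos

theorem factorizations_of_orderOf_prime {K : Type*} [Group K] [Finite K]
    (hK : Nat.card K = 60) (hprime : ∀ x : K, x ≠ 1 → (orderOf x).Prime) :
    (prodElementOrders K).factorization 2 = 15 ∧ (prodElementOrders K).factorization 3 = 20 ∧
      (prodElementOrders K).factorization 5 = 24 := by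
  classical
  have := Fintype.ofFinite K
  have hs := sum_cardFactors_orderOf hK
  have hsum : ∑ x : K, ArithmeticFunction.cardFactors (orderOf x) = 59 := by
    rw [← Finset.sum_erase Finset.univ (a := (1 : K)) (by simp),
      Finset.sum_congr rfl fun x hx => ArithmeticFunction.cardFactors_eq_one_iff_prime.2
        (hprime x (Finset.ne_of_mem_erase hx)), Finset.sum_const,
      Finset.card_erase_of_mem (Finset.mem_univ _), Finset.card_univ,
      ← Nat.card_eq_fintype_card, hK]
    rfl
  rw [hsum] at hs
  have f2 : (60 : ℕ).factorization 2 = 2 := by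
    rw [show 60 = 2 ^ 2 * 15 by norm_num, Nat.factorization_mul_apply_of_coprime (by norm_num),
      Nat.prime_two.factorization_pow]
    simp [Nat.factorization_eq_zero_of_not_dvd]
  have f3 : (60 : ℕ).factorization 3 = 1 := by
    rw [show 60 = 3 * 20 by norm_num, Nat.factorization_mul_apply_of_coprime (by norm_num),
      Nat.prime_three.factorization_self]
    simp [Nat.factorization_eq_zero_of_not_dvd]
  have f5 : (60 : ℕ).factorization 5 = 1 := by
    rw [show 60 = 5 * 12 by norm_num, Nat.factorization_mul_apply_of_coprime (by norm_num),
      Nat.prime_five.factorization_self]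
    simp [Nat.factorization_eq_zero_of_not_dvd]
  have d32 :=
    ordProj_dvd_prodElementOrders_factorization K Nat.prime_three Nat.prime_two (by decide)
  have d52 := ordProj_dvd_prodElementOrders_factorization K Nat.prime_five Nat.prime_two (by decide)
  have d23 :=
    ordProj_dvd_prodElementOrders_factorization K Nat.prime_two Nat.prime_three (by decide)
  have d53 :=
    ordProj_dvd_prodElementOrders_factorization K Nat.prime_five Nat.prime_three (by decide)
  have d25 := ordProj_dvd_prodElementOrders_factorization K Nat.prime_two Nat.prime_five (by decide)
  have d35 :=
    ordProj_dvd_prodElementOrders_factorization K Nat.prime_three Nat.prime_five (by decide)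
  rw [hK] at d32 d52 d23 d53 d25 d35
  rw [f3] at d32 d35
  rw [f5] at d52 d53
  rw [f2] at d23 d25
  have p2 := factorization_prodElementOrders_pos (K := K) Nat.prime_two (hK ▸ by norm_num)
  have p3 := factorization_prodElementOrders_pos (K := K) Nat.prime_three (hK ▸ by norm_num)
  have p5 := factorization_prodElementOrders_pos (K := K) Nat.prime_five (hK ▸ by norm_num)
  generalize (prodElementOrders K).factorization 2 = a at *
  generalize (prodElementOrders K).factorization 3 = b at *
  generalize (prodElementOrders K).factorization 5 = c at *
  clear f2 f3 f5 hsum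
  -- The exponents are positive multiples of 15, 20, 12 with sum 59; only 15, 20, 24 fit.
  omega

/-! ### Recognition of the alternating group of degree 5 -/

/-- Cycles of `σ` have length 1 or `q`, and a `q`-cycle does not fit into `S`. -/
theorem Equiv.Perm.apply_eq_self_of_pow_prime_eq_one {α : Type*} {σ : Equiv.Perm α} {q : ℕ}
    (hq : q.Prime) (hσ : σ ^ q = 1) {S : Set α} (hfin : S.Finite) (hS : ∀ x ∈ S, σ x ∈ S)
    (hcard : S.ncard < q) {x : α} (hx : x ∈ S) : σ x = x := by
  have hper : Function.IsPeriodicPt σ q x := by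
    rw [Function.IsPeriodicPt, Function.IsFixedPt, Equiv.Perm.iterate_eq_pow, hσ]
    rfl
  rcases (Nat.dvd_prime hq).1 hper.minimalPeriod_dvd with h | h
  · exact Function.minimalPeriod_eq_one_iff_isFixedPt.1 h
  · refine absurd hcard (not_lt.2 ?_)
    have hmem : ∀ i, σ^[i] x ∈ S := by
      intro i
      induction i with
      | zero => exact hx
      | succ i ih => rw [Function.iterate_succ_apply']; exact hS _ ih
    have := Set.ncard_le_ncard_of_injOn (fun i => σ^[i] x) (fun i _ => hmem i)
      (Function.iterate_injOn_Iio_minimalPeriod (f := σ) (x := x)) hfin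
    rwa [h, show Set.Iio q = ((Finset.range q : Finset ℕ) : Set ℕ) by simp,
      Set.ncard_coe_finset, Finset.card_range] at this

theorem commute_of_conj_mem_of_card_lt {K : Type*} [Group K] [Finite K] {g : K}
    (hg : (orderOf g).Prime) {H : Subgroup K} (hH : ∀ x ∈ H, g * x * g⁻¹ ∈ H)
    (hcard : Nat.card H < orderOf g) {x : K} (hx : x ∈ H) : Commute g x := by
  have h := Equiv.Perm.apply_eq_self_of_pow_prime_eq_one (σ := (MulAut.conj g).toEquiv)
    (S := (H : Set K)) hg (by
      ext y
      have : (MulAut.toPerm K (MulAut.conj g)) ^ orderOf g = 1 := by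
        rw [← map_pow, ← map_pow, pow_orderOf_eq_one, map_one, map_one]
      exact congrArg (fun σ : Equiv.Perm K => σ y) this) (Set.toFinite _) hH hcard hx
  change g * x * g⁻¹ = x at h
  exact mul_inv_eq_iff_eq_mul.1 h

section OrderSixty

variable {K : Type*} [Group K] [Finite K]

/-- Otherwise the product would have order a product of two distinct primes. -/
theorem orderOf_eq_of_commute {K : Type*} [Group K]
    (hprime : ∀ x : K, x ≠ 1 → (orderOf x).Prime) {x y : K}
    (hx : x ≠ 1) (hy : y ≠ 1) (h : Commute x y) : orderOf x = orderOf y := by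
  by_contra hne
  have hmul := h.orderOf_mul_eq_mul_orderOf_of_coprime
    ((Nat.coprime_primes (hprime x hx) (hprime y hy)).2 hne)
  have hxy : x * y ≠ 1 := by
    intro h1
    rw [h1, orderOf_one, eq_comm, mul_eq_one] at hmul
    exact hx (orderOf_eq_one_iff.1 hmul.1)
  have := hprime _ hxy
  rw [hmul] at this
  exact Nat.not_prime_mul (hprime x hx).ne_one (hprime y hy).ne_one this

theorem card_sylow_two_subgroup (hK : Nat.card K = 60) (V : Sylow 2 K) : Nat.card V = 4 := by
  rw [V.card_eq_multiplicity, hK, show 60 = 2 ^ 2 * 15 by norm_num,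
    Nat.factorization_mul_apply_of_coprime (by norm_num), Nat.prime_two.factorization_pow]
  simp [Nat.factorization_eq_zero_of_not_dvd]

theorem orderOf_eq_two_of_mem_sylow {K : Type*} [Group K]
    (hprime : ∀ x : K, x ≠ 1 → (orderOf x).Prime)
    {V : Sylow 2 K} {x : K} (hx : x ∈ V) (hx1 : x ≠ 1) : orderOf x = 2 := by
  obtain ⟨k, hk⟩ := (IsPGroup.iff_orderOf.1 V.isPGroup') ⟨x, hx⟩
  rw [Subgroup.orderOf_mk] at hk
  exact (Nat.prime_dvd_prime_iff_eq (hprime x hx1) Nat.prime_two).1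
    ((hprime x hx1).dvd_of_dvd_pow hk.dvd)

/-- Elements commuting with the involution `x` have order 1 or 2, so the centralizer is a 2-group;
it contains `V`, which has exponent 2 and so is abelian. Maximality of `V` concludes. -/
theorem centralizer_eq_sylow_of_mem {K : Type*} [Group K]
    (hprime : ∀ x : K, x ≠ 1 → (orderOf x).Prime)
    {V : Sylow 2 K} {x : K} (hx : x ∈ V) (hx1 : x ≠ 1) :
    Subgroup.centralizer {x} = V := by
  refine V.is_maximal' ?_ fun y hy => ?_
  · rw [IsPGroup.iff_orderOf]
    rintro ⟨y, hy⟩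
    rw [Subgroup.orderOf_mk]
    by_cases hy1 : y = 1
    · exact ⟨0, by simp [hy1]⟩
    · refine ⟨1, ?_⟩
      rw [pow_one, orderOf_eq_of_commute hprime hy1 hx1
        (Subgroup.mem_centralizer_singleton_iff.1 hy), orderOf_eq_two_of_mem_sylow hprime hx hx1]
  · have hsq : ∀ z ∈ V, z * z = 1 := by
      intro z hz
      by_cases hz1 : z = 1
      · rw [hz1, one_mul]
      · rw [← pow_two, ← orderOf_eq_two_of_mem_sylow hprime hz hz1, pow_orderOf_eq_one]
    have hinv : ∀ z ∈ V, z⁻¹ = z := fun z hz => inv_eq_of_mul_eq_one_left (hsq z hz)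
    rw [Subgroup.mem_centralizer_singleton_iff]
    have := hinv _ (mul_mem hx hy)
    rwa [mul_inv_rev, hinv x hx, hinv y hy] at this

theorem sylow_two_eq_of_mem {K : Type*} [Group K]
    (hprime : ∀ x : K, x ≠ 1 → (orderOf x).Prime)
    {V W : Sylow 2 K} {x : K} (hV : x ∈ V) (hW : x ∈ W) (hx1 : x ≠ 1) : V = W :=
  Sylow.ext ((centralizer_eq_sylow_of_mem hprime hV hx1).symm.trans
    (centralizer_eq_sylow_of_mem hprime hW hx1))

theorem card_orderOf_eq_two (hprime : ∀ x : K, x ≠ 1 → (orderOf x).Prime) :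
    Nat.card {x : K // orderOf x = 2} = (prodElementOrders K).factorization 2 := by
  classical
  have := Fintype.ofFinite K
  rw [prodElementOrders_factorization, Nat.card_eq_fintype_card, Fintype.card_subtype,
    Finset.card_filter]
  refine Finset.sum_congr rfl fun x _ => ?_
  split_ifs with h
  · rw [h, Nat.prime_two.factorization_self]
  · symm
    rcases eq_or_ne x 1 with rfl | hx
    · simp
    · refine Nat.factorization_eq_zero_of_not_dvd fun hd => h ?_
      exact ((Nat.prime_dvd_prime_iff_eq Nat.prime_two (hprime x hx)).1 hd).symm

/-- The 15 involutions are partitioned by the Sylow 2-subgroups, three to each. -/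
theorem card_sylow_two_eq_five (hK : Nat.card K = 60)
    (hprime : ∀ x : K, x ≠ 1 → (orderOf x).Prime) : Nat.card (Sylow 2 K) = 5 := by
  classical
  have := Fintype.ofFinite K
  have := Fintype.ofFinite (Sylow 2 K)
  have h15 := card_orderOf_eq_two hprime
  rw [(factorizations_of_orderOf_prime hK hprime).1] at h15
  have hV : ∀ V : Sylow 2 K, Nat.card {x : V // x ≠ 1} = 3 := by
    intro V
    have := Fintype.ofFinite V
    rw [Nat.card_eq_fintype_card, Fintype.card_subtype_compl, Fintype.card_subtype_eq,
      ← Nat.card_eq_fintype_card]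
    exact congrArg (· - 1) (card_sylow_two_subgroup hK V)
  let f : (Σ V : Sylow 2 K, {x : V // x ≠ 1}) → {x : K // orderOf x = 2} := fun s =>
    ⟨s.2.1.1, orderOf_eq_two_of_mem_sylow hprime s.2.1.2 fun h => s.2.2 (Subtype.ext h)⟩
  have hf : Function.Bijective f := by
    constructor
    · rintro ⟨V, ⟨x, hx⟩, hx1⟩ ⟨W, ⟨y, hy⟩, hy1⟩ h
      have hxy : x = y := congrArg Subtype.val h
      subst hxy
      obtain rfl : V = W := sylow_two_eq_of_mem hprime hx hy fun h => hx1 (Subtype.ext h)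
      rfl
    · rintro ⟨x, hx⟩
      have hp : IsPGroup 2 (Subgroup.zpowers x) :=
        IsPGroup.of_card (n := 1) (by rw [Nat.card_zpowers, hx, pow_one])
      obtain ⟨V, hV⟩ := hp.exists_le_sylow
      refine ⟨⟨V, ⟨x, hV (Subgroup.mem_zpowers x)⟩, fun h => ?_⟩, rfl⟩
      have h1 : x = 1 := congrArg Subtype.val h
      rw [h1, orderOf_one] at hx
      exact absurd hx (by decide)
  rw [← Nat.card_congr (Equiv.ofBijective f hf), Nat.card_sigma,
    Finset.sum_congr rfl fun V _ => hV V, Finset.sum_const, Finset.card_univ,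
    ← Nat.card_eq_fintype_card, smul_eq_mul] at h15
  omega

theorem conj_mem_of_mem_ker_toPermHom {K : Type*} [Group K] {m : K}
    (hm : m ∈ (MulAction.toPermHom K (Sylow 2 K)).ker) (V : Sylow 2 K) {x : K} (hx : x ∈ V) :
    m * x * m⁻¹ ∈ V := by
  have h : m • V = V := congrArg (fun σ : Equiv.Perm (Sylow 2 K) => σ V) hm
  exact (Subgroup.mem_normalizer_iff.1 (Sylow.smul_eq_iff_mem_normalizer.1 h) x).1 hx

theorem orderOf_eq_three_of_mem_ker (hK : Nat.card K = 60)
    (hprime : ∀ x : K, x ≠ 1 → (orderOf x).Prime) {m : K}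
    (hm : m ∈ (MulAction.toPermHom K (Sylow 2 K)).ker) (hm1 : m ≠ 1) : orderOf m = 3 := by
  have hn := card_sylow_two_eq_five hK hprime
  have hcases : orderOf m = 2 ∨ orderOf m = 3 ∨ orderOf m = 5 := by
    have h1 : orderOf m ∣ 2 ^ 2 * 3 * 5 := by
      have := orderOf_dvd_natCard m
      rwa [hK] at this
    have hp := hprime m hm1
    rcases hp.dvd_mul.1 h1 with h | h
    · rcases hp.dvd_mul.1 h with h | h
      · exact Or.inl ((Nat.prime_dvd_prime_iff_eq hp Nat.prime_two).1 (hp.dvd_of_dvd_pow h))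
      · exact Or.inr (Or.inl ((Nat.prime_dvd_prime_iff_eq hp Nat.prime_three).1 h))
    · exact Or.inr (Or.inr ((Nat.prime_dvd_prime_iff_eq hp Nat.prime_five).1 h))
  have hne : ∀ V : Sylow 2 K, ∃ x ∈ V, x ≠ 1 := by
    intro V
    have : Nontrivial V := by
      rw [← Finite.one_lt_card_iff_nontrivial, card_sylow_two_subgroup hK]
      norm_num
    obtain ⟨x, hx⟩ := exists_ne (1 : V)
    exact ⟨x, x.2, fun h => hx (Subtype.ext h)⟩
  rcases hcases with h | h | h
  · exfalso
    obtain ⟨V, hV⟩ : ∃ V : Sylow 2 K, m ∉ V := by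
      have : Nontrivial (Sylow 2 K) := by
        rw [← Finite.one_lt_card_iff_nontrivial, hn]
        norm_num
      obtain ⟨V, W, hVW⟩ := exists_pair_ne (Sylow 2 K)
      by_contra! hall
      exact hVW (sylow_two_eq_of_mem hprime (hall V) (hall W) hm1)
    obtain ⟨x, hx, hx1⟩ := hne V
    have hkey : ∀ z ∈ V, z ≠ 1 → m * z * m⁻¹ ≠ z := by
      intro z hz hz1 hmz
      refine hV ?_
      have : m ∈ Subgroup.centralizer {z} :=
        Subgroup.mem_centralizer_singleton_iff.2 (mul_inv_eq_iff_eq_mul.1 hmz)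
      rwa [centralizer_eq_sylow_of_mem hprime hz hz1] at this
    have hmx := conj_mem_of_mem_ker_toPermHom hm V hx
    have hcomm : x * (m * x * m⁻¹) = m * x * m⁻¹ * x := by
      have : m * x * m⁻¹ ∈ Subgroup.centralizer {x} := by
        rwa [centralizer_eq_sylow_of_mem hprime hx hx1]
      exact (Subgroup.mem_centralizer_singleton_iff.1 this).symm
    have hmm : m⁻¹ = m := by
      rw [inv_eq_iff_mul_eq_one, ← pow_two, ← h, pow_orderOf_eq_one]
    have hxx : x⁻¹ = x := by
      rw [inv_eq_iff_mul_eq_one, ← pow_two, ← orderOf_eq_two_of_mem_sylow hprime hx hx1,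
        pow_orderOf_eq_one]
    -- Conjugation by the involution `m` swaps the commuting factors `x` and `m * x * m⁻¹`, so it
    -- fixes their product, which is nontrivial because `m` does not fix `x`.
    refine hkey _ (mul_mem hx hmx) (fun h1 => hkey x hx hx1 ?_) ?_
    · rw [← inv_eq_iff_mul_eq_one, hxx] at h1
      exact h1.symm
    · have hm2 : m * m = 1 := by
        nth_rewrite 1 [← hmm]
        exact inv_mul_cancel m
      rw [hcomm, hmm]
      calc m * (m * x * m * x) * m = (m * m) * x * m * x * m := by simp only [mul_assoc]
        _ = x * (m * x * m) := by rw [hm2, one_mul]; simp only [mul_assoc]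
        _ = m * x * m * x := by rwa [hmm] at hcomm
  · exact h
  · exfalso
    obtain ⟨V⟩ : Nonempty (Sylow 2 K) := inferInstance
    obtain ⟨x, hx, hx1⟩ := hne V
    -- An element of order 5 cannot permute the four elements of `V` nontrivially.
    have hc : Commute m x := by
      refine commute_of_conj_mem_of_card_lt (H := V) (h ▸ Nat.prime_five)
        (fun y hy => conj_mem_of_mem_ker_toPermHom hm V hy) ?_ hx
      rw [h]
      exact (card_sylow_two_subgroup hK V).trans_lt (by norm_num)
    have := orderOf_eq_of_commute hprime hm1 hx1 hc
    rw [h, orderOf_eq_two_of_mem_sylow hprime hx hx1] at this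
    exact absurd this (by decide)

/-- A nontrivial kernel would have order 3; an element of order 5 would then centralize it, against
equality of orders of commuting elements. -/
theorem toPermHom_sylow_two_injective (hK : Nat.card K = 60)
    (hprime : ∀ x : K, x ≠ 1 → (orderOf x).Prime) :
    Function.Injective (MulAction.toPermHom K (Sylow 2 K)) := by
  rw [← MonoidHom.ker_eq_bot_iff, Subgroup.eq_bot_iff_forall]
  by_contra! hcon
  obtain ⟨m, hm, hm1⟩ := hcon
  set M := (MulAction.toPermHom K (Sylow 2 K)).ker with hM
  have := Fact.mk Nat.prime_three
  have := Fact.mk Nat.prime_five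
  have hM3 : IsPGroup 3 M := by
    rw [IsPGroup.iff_orderOf]
    rintro ⟨y, hy⟩
    rw [Subgroup.orderOf_mk]
    by_cases hy1 : y = 1
    · exact ⟨0, by simp [hy1]⟩
    · exact ⟨1, by rw [pow_one, orderOf_eq_three_of_mem_ker hK hprime hy hy1]⟩
  obtain ⟨n, hn⟩ := IsPGroup.iff_card.1 hM3
  have hn1 : n ≤ 1 := by
    by_contra! h
    have h1 : 3 ^ 2 ∣ Nat.card M := hn ▸ pow_dvd_pow 3 h
    have h2 := h1.trans (Subgroup.card_subgroup_dvd_card M)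
    rw [hK] at h2
    exact absurd h2 (by decide)
  have hMc : Nat.card M < 5 := by
    rw [hn]
    exact (Nat.pow_le_pow_right (by norm_num) hn1).trans_lt (by norm_num)
  obtain ⟨c, hc⟩ := exists_prime_orderOf_dvd_card' (G := K) 5 (hK ▸ by norm_num)
  have hcomm : Commute c m := commute_of_conj_mem_of_card_lt (H := M) (hc ▸ Nat.prime_five)
    (fun x hx => Subgroup.Normal.conj_mem inferInstance x hx c) (hc ▸ hMc) hm
  have hc1 : c ≠ 1 := by
    rintro rfl
    rw [orderOf_one] at hc
    exact absurd hc (by decide)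
  have := orderOf_eq_of_commute hprime hc1 hm1 hcomm
  rw [hc, orderOf_eq_three_of_mem_ker hK hprime hm hm1] at this
  exact absurd this (by decide)

theorem nonempty_mulEquiv_alternatingGroup_five (hK : Nat.card K = 60)
    (hprime : ∀ x : K, x ≠ 1 → (orderOf x).Prime) :
    Nonempty (K ≃* alternatingGroup (Fin 5)) := by
  classical
  have := Fintype.ofFinite (Sylow 2 K)
  have hn := card_sylow_two_eq_five hK hprime
  let e := MonoidHom.ofInjective (toPermHom_sylow_two_injective hK hprime)
  have hidx : (MulAction.toPermHom K (Sylow 2 K)).range.index = 2 := by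
    have h := Subgroup.index_mul_card (MulAction.toPermHom K (Sylow 2 K)).range
    rw [← Nat.card_congr e.toEquiv, hK, Nat.card_perm, hn, show Nat.factorial 5 = 120 from rfl] at h
    omega
  have e5 : Sylow 2 K ≃ Fin 5 := Finite.equivFinOfCardEq hn
  exact ⟨(e.trans (MulEquiv.subgroupCongr
    (Equiv.Perm.eq_alternatingGroup_of_index_eq_two hidx))).trans (Equiv.altCongrHom e5)⟩

end OrderSixty

/-! ### PSL(2,5): order 60 and prime element orders -/

theorem card_specialLinearGroup_two_five :
    Nat.card (Matrix.SpecialLinearGroup (Fin 2) (ZMod 5)) = 120 := by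
  let e : Matrix.SpecialLinearGroup (Fin 2) (ZMod 5) ≃
      {v : ZMod 5 × ZMod 5 × ZMod 5 × ZMod 5 // v.1 * v.2.2.2 - v.2.1 * v.2.2.1 = 1} :=
    { toFun := fun A => ⟨(A 0 0, A 0 1, A 1 0, A 1 1),
        (Matrix.det_fin_two A.1).symm.trans A.det_coe⟩
      invFun := fun v => ⟨!![v.1.1, v.1.2.1; v.1.2.2.1, v.1.2.2.2], by
        rw [Matrix.det_fin_two_of]; exact v.2⟩
      left_inv := fun A => by
        ext i j
        fin_cases i <;> fin_cases j <;> rfl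
      right_inv := fun v => rfl }
  rw [Nat.card_congr e, Nat.card_eq_fintype_card]
  decide +kernel

theorem card_center_specialLinearGroup_two_five :
    Nat.card (Subgroup.center (Matrix.SpecialLinearGroup (Fin 2) (ZMod 5))) = 2 := by
  rw [Nat.card_congr (Matrix.SpecialLinearGroup.center_equiv_rootsOfUnity' (0 : Fin 2)).toEquiv,
    Fintype.card_fin]
  let e : rootsOfUnity 2 (ZMod 5) ≃ {u : (ZMod 5)ˣ // u ^ 2 = 1} :=
    Equiv.subtypeEquivRight fun u => Iff.rfl
  rw [Nat.card_congr e, Nat.card_eq_fintype_card]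
  decide +kernel

theorem card_projectiveSpecialLinearGroup_two_five :
    Nat.card (Matrix.ProjectiveSpecialLinearGroup (Fin 2) (ZMod 5)) = 60 := by
  have h := Subgroup.index_mul_card (Subgroup.center (Matrix.SpecialLinearGroup (Fin 2) (ZMod 5)))
  rw [card_center_specialLinearGroup_two_five, card_specialLinearGroup_two_five] at h
  rw [← Subgroup.index_eq_card]
  omega

/-- Exhaustive check; modulo scalars it bounds the element orders of PSL(2,5) to 1, 2, 3, 5. -/
theorem matrix_pow_eq_one_or_neg_one (a b c d : ZMod 5) (h : a * d - b * c = 1) :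
    ∃ k ∈ [2, 3, 5], ∃ r ∈ [(1 : ZMod 5), -1], !![a, b; c, d] ^ k = !![r, 0; 0, r] := by
  revert a b c d
  decide +kernel

theorem exists_prime_pow_mem_center (A : Matrix.SpecialLinearGroup (Fin 2) (ZMod 5)) :
    ∃ k : ℕ, k.Prime ∧ A ^ k ∈ Subgroup.center (Matrix.SpecialLinearGroup (Fin 2) (ZMod 5)) := by
  obtain ⟨k, hk, r, hr, h⟩ := matrix_pow_eq_one_or_neg_one (A 0 0) (A 0 1) (A 1 0) (A 1 1)
    ((Matrix.det_fin_two A.1).symm.trans A.det_coe)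
  rw [← Matrix.eta_fin_two A.1] at h
  refine ⟨k, ?_, Matrix.SpecialLinearGroup.mem_center_iff.2 ⟨r, ?_, ?_⟩⟩
  · simp only [List.mem_cons, List.not_mem_nil, or_false] at hk
    rcases hk with rfl | rfl | rfl <;> norm_num
  · simp only [List.mem_cons, List.not_mem_nil, or_false] at hr
    rcases hr with rfl | rfl <;> decide
  · rw [Matrix.SpecialLinearGroup.coe_pow, h]
    ext i j
    fin_cases i <;> fin_cases j <;> simp

theorem orderOf_prime_projectiveSpecialLinearGroup
    (x : Matrix.ProjectiveSpecialLinearGroup (Fin 2) (ZMod 5)) (hx : x ≠ 1) :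
    (orderOf x).Prime := by
  induction x using QuotientGroup.induction_on with | H A => ?_
  obtain ⟨k, hk, hA⟩ := exists_prime_pow_mem_center A
  have h1 : (A : Matrix.ProjectiveSpecialLinearGroup (Fin 2) (ZMod 5)) ^ k = 1 := by
    rw [← QuotientGroup.mk_pow, QuotientGroup.eq_one_iff]
    exact hA
  have := Fact.mk hk
  rw [orderOf_eq_prime h1 hx]
  exact hk

/-! ### Splitting off a central Sylow `p`-subgroup -/

theorem not_dvd_sixty {p : ℕ} (hp : p.Prime) (hp5 : 5 < p) : ¬ p ∣ 60 := by
  rw [show 60 = 2 * 2 * 3 * 5 by norm_num]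
  intro h
  rcases hp.dvd_mul.1 h with h | h
  · rcases hp.dvd_mul.1 h with h | h
    · rcases hp.dvd_mul.1 h with h | h <;> linarith [Nat.le_of_dvd (by norm_num) h]
    · linarith [Nat.le_of_dvd (by norm_num) h]
  · linarith [Nat.le_of_dvd (by norm_num) h]

-- For q = 2, 3, 5 the number of Sylow `q`-subgroups is prime to `p`, so `φ` stabilizes one. It has
-- at most 5 < `p` elements, so is fixed pointwise. Hence 4, 3 and 5 divide the order of the fixed
-- subgroup `H`.
open scoped Pointwise in
theorem MulAut.eq_one_of_card_sixty {K : Type*} [Group K] [Finite K] (hK : Nat.card K = 60)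
    {p : ℕ} (hp : p.Prime) (hp5 : 5 < p) {φ : MulAut K} (hφ : φ ^ p = 1) : φ = 1 := by
  have := Fact.mk hp
  let H : Subgroup K := φ.toMonoidHom.eqLocus (MonoidHom.id K)
  have hpg : IsPGroup p (Subgroup.zpowers φ) := by
    rintro ⟨x, k, rfl⟩
    refine ⟨1, Subtype.ext ?_⟩
    change (φ ^ k) ^ p ^ 1 = 1
    rw [pow_one, ← zpow_natCast, ← zpow_mul, mul_comm, zpow_mul, zpow_natCast, hφ, one_zpow]
  have key : ∀ q a : ℕ, q.Prime → q ^ a ∣ 60 → q ^ a ≤ 5 → ¬ q ∣ 60 / q ^ a →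
      q ^ a ∣ Nat.card H := by
    intro q a hq hqa hle hndvd
    have := Fact.mk hq
    obtain ⟨Q, hQ⟩ := hpg.nonempty_fixed_point_of_prime_not_dvd_card (Sylow q K) fun h => by
      obtain ⟨Q⟩ : Nonempty (Sylow q K) := inferInstance
      have h2 := (h.trans Q.card_dvd_index).trans (Subgroup.index_dvd_card _)
      rw [hK] at h2
      exact not_dvd_sixty hp hp5 h2
    have hcard : Nat.card Q = q ^ a := by
      have hval : (60 : ℕ).factorization q = a := by
        rw [← Nat.mul_div_cancel' hqa, Nat.factorization_mul (pow_ne_zero _ hq.ne_zero)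
          (fun h => hndvd (by rw [h]; exact dvd_zero q)), Finsupp.add_apply,
          Nat.factorization_eq_zero_of_not_dvd hndvd, hq.factorization_pow]
        simp
      rw [Q.card_eq_multiplicity, hK, hval]
    have hQφ : φ • Q = Q := hQ ⟨φ, Subgroup.mem_zpowers φ⟩
    rw [← hcard]
    refine Subgroup.card_dvd_of_le fun x hx => ?_
    change φ x = x
    have hmem : ∀ y ∈ (Q : Set K), φ y ∈ (Q : Set K) := by
      intro y hy
      have : φ • y ∈ φ • (Q : Subgroup K) := Subgroup.smul_mem_pointwise_smul y φ _ hy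
      rw [← Sylow.pointwise_smul_def, hQφ] at this
      exact this
    refine Equiv.Perm.apply_eq_self_of_pow_prime_eq_one (σ := MulAut.toPerm K φ) hp ?_
      (Set.toFinite _) hmem ?_ hx
    · rw [← map_pow, hφ, map_one]
    · exact (hcard.trans_le hle).trans_lt hp5
  have h4 := key 2 2 Nat.prime_two (by norm_num) (by norm_num) (by norm_num)
  have h3 := key 3 1 Nat.prime_three (by norm_num) (by norm_num) (by norm_num)
  have h5 := key 5 1 Nat.prime_five (by norm_num) (by norm_num) (by norm_num)
  have h60 : 60 ∣ Nat.card H := by omega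
  have htop : H = ⊤ := by
    refine Subgroup.eq_top_of_le_card H ?_
    rw [hK]
    exact Nat.le_of_dvd Nat.card_pos h60
  ext x
  have : x ∈ H := htop ▸ Subgroup.mem_top x
  exact this

section CentralSylow

variable {G : Type*} [Group G] [Finite G] {p : ℕ}

theorem factorization_mul_self_of_not_dvd (hp : p.Prime) {n : ℕ} (hn : ¬ p ∣ n) :
    (n * p).factorization p = 1 := by
  rw [Nat.factorization_mul (fun h => hn (by rw [h]; exact dvd_zero p)) hp.ne_zero,
    Finsupp.add_apply, Nat.factorization_eq_zero_of_not_dvd hn, hp.factorization_self]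

theorem Sylow.card_eq_prime [Fact p.Prime] {n : ℕ} (hG : Nat.card G = n * p) (hn : ¬ p ∣ n)
    (P : Sylow p G) : Nat.card P = p := by
  rw [P.card_eq_multiplicity, hG, factorization_mul_self_of_not_dvd Fact.out hn, pow_one]

theorem Sylow.le_centralizer_of_card_eq_prime {G : Type*} [Group G] {p : ℕ}
    [hp : Fact p.Prime] (P : Sylow p G) (hP : Nat.card P = p) : (P : Subgroup G) ≤ Subgroup.centralizer (P : Set G) := by
  have : IsCyclic P := isCyclic_of_prime_card hP
  intro x hx
  rw [Subgroup.mem_centralizer_iff]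
  intro y hy
  obtain ⟨g, hg⟩ := IsCyclic.exists_generator (α := P)
  obtain ⟨i, hi⟩ := hg ⟨x, hx⟩
  obtain ⟨j, hj⟩ := hg ⟨y, hy⟩
  have h : (g ^ j) * (g ^ i) = (g ^ i) * (g ^ j) := by rw [← zpow_add, ← zpow_add, add_comm]
  change g ^ i = _ at hi
  change g ^ j = _ at hj
  rw [hi, hj] at h
  exact congrArg Subtype.val h

/-- `P` is normal of coprime index `c` in its centralizer; a Schur–Zassenhaus complement supplies
`c` elements of order prime to `p`. -/
theorem card_dvd_orderOf_centralizer_le [hp : Fact p.Prime] {n : ℕ} (hG : Nat.card G = n * p)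
    (hn : ¬ p ∣ n) (P : Sylow p G) :
    ∃ c, Nat.card (Subgroup.centralizer (P : Set G)) = c * p ∧
      Nat.card {g : Subgroup.centralizer (P : Set G) // p ∣ orderOf g} ≤ c * (p - 1) := by
  have hPc := P.card_eq_prime hG hn
  have hle := P.le_centralizer_of_card_eq_prime hPc
  set C := Subgroup.centralizer (P : Set G) with hC
  let N : Subgroup C := (P : Subgroup G).subgroupOf C
  have hNc : Nat.card N = p :=
    (Nat.card_congr (Subgroup.subgroupOfEquivOfLe hle).toEquiv).trans hPc
  have : N.Normal := by
    refine ⟨fun x hx g => ?_⟩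
    have h : (x : G) * g = g * x := Subgroup.mem_centralizer_iff.1 g.2 x hx
    have : g * x * g⁻¹ = x := by
      rw [mul_inv_eq_iff_eq_mul]
      exact Subtype.ext h.symm
    rwa [this]
  have hidx : N.index * p = Nat.card C := by rw [← hNc, Subgroup.index_mul_card]
  have hndvd : ¬ p ∣ N.index := by
    intro h
    have h1 : p * p ∣ n * p := by
      rw [← hG]
      exact ((mul_dvd_mul_right h p).trans (dvd_of_eq hidx)).trans
        (Subgroup.card_subgroup_dvd_card C)
    exact hn (Nat.dvd_of_mul_dvd_mul_right hp.out.pos h1)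
  obtain ⟨H, hH⟩ := Subgroup.exists_right_complement'_of_coprime (N := N) (by
    rw [hNc]; exact (Nat.Prime.coprime_iff_not_dvd hp.out).2 hndvd)
  have hHc : Nat.card H = N.index := hH.symm.index_eq_card.symm
  refine ⟨N.index, hidx.symm, ?_⟩
  have hadd : Nat.card {g : C // p ∣ orderOf g} + Nat.card H ≤ Nat.card C := by
    rw [← Nat.card_sum]
    refine Nat.card_le_card_of_injective (Sum.elim Subtype.val Subtype.val)
      (Function.Injective.sumElim Subtype.val_injective Subtype.val_injective ?_)
    rintro ⟨g, hg⟩ h heq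
    refine hndvd (hHc ▸ hg.trans ?_)
    change g = h at heq
    rw [heq, Subgroup.orderOf_coe]
    exact orderOf_dvd_natCard h
  rw [hHc, ← hidx] at hadd
  rw [Nat.mul_sub_one]
  omega

/-- A suitable power of `g` generates a subgroup of order `p`, which is a Sylow subgroup centralized
by `g`. -/
theorem card_dvd_orderOf_le_sum [hp : Fact p.Prime] [Fintype (Sylow p G)] {n : ℕ}
    (hG : Nat.card G = n * p) (hn : ¬ p ∣ n) :
    Nat.card {g : G // p ∣ orderOf g} ≤
      ∑ P : Sylow p G, Nat.card {g : Subgroup.centralizer (P : Set G) // p ∣ orderOf g} := by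
  rw [← Nat.card_sigma]
  have hex : ∀ g : {g : G // p ∣ orderOf g}, ∃ P : Sylow p G,
      g.1 ∈ Subgroup.centralizer (P : Set G) := by
    rintro ⟨g, hg⟩
    have ho : orderOf (g ^ (orderOf g / p)) = p := by
      rw [orderOf_pow_of_dvd (Nat.div_pos (Nat.le_of_dvd (orderOf_pos g) hg) hp.out.pos).ne'
        (Nat.div_dvd_of_dvd hg), Nat.div_div_self hg (orderOf_pos g).ne']
    have hz : Nat.card (Subgroup.zpowers (g ^ (orderOf g / p))) = p := by
      rw [Nat.card_zpowers, ho]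
    obtain ⟨P, hP⟩ := (IsPGroup.of_card (n := 1) (hz.trans (pow_one p).symm)).exists_le_sylow
    have heq := Subgroup.eq_of_le_of_card_ge hP ((P.card_eq_prime hG hn).trans hz.symm).le
    refine ⟨P, Subgroup.mem_centralizer_iff.2 fun x hx => ?_⟩
    have hx' : x ∈ (P : Subgroup G) := hx
    rw [← heq] at hx'
    obtain ⟨k, rfl⟩ := hx'
    exact (((Commute.refl g).pow_left _).zpow_left k).eq
  choose f hf using hex
  refine Nat.card_le_card_of_injective
    (fun g => ⟨f g, ⟨⟨g.1, hf g⟩, by rw [Subgroup.orderOf_mk]; exact g.2⟩⟩) fun g h hgh => ?_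
  have := congrArg (fun s : (Σ P : Sylow p G,
    {g : Subgroup.centralizer (P : Set G) // p ∣ orderOf g}) => (s.2.1 : G)) hgh
  exact Subtype.ext this

/-- With `|C(Q)| = c Q * p`, the hypothesis gives `n ≤ ∑ c Q`, while `C(Q) ≤ N(Q)` bounds each `c Q`
by `n` over the number of Sylow subgroups. Equality holds throughout. -/
theorem normalizer_le_centralizer_of_card_dvd_orderOf [hp : Fact p.Prime] {n : ℕ}
    (hG : Nat.card G = n * p) (hn : ¬ p ∣ n)
    (hsing : n * (p - 1) ≤ Nat.card {g : G // p ∣ orderOf g}) (P : Sylow p G) :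
    Subgroup.normalizer (P : Set G) ≤ Subgroup.centralizer (P : Set G) := by
  classical
  have := Fintype.ofFinite (Sylow p G)
  choose c hc hcle using fun P : Sylow p G => card_dvd_orderOf_centralizer_le hG hn P
  have hp1 : 0 < p - 1 := Nat.sub_pos_of_lt hp.out.one_lt
  have hCN : ∀ Q : Sylow p G,
      Subgroup.centralizer (Q : Set G) ≤ Subgroup.normalizer (Q : Set G) := by
    exact fun Q => Subgroup.centralizer_le_normalizer _
  have hN : ∀ Q : Sylow p G,
      Nat.card (Sylow p G) * Nat.card (Subgroup.normalizer (Q : Set G)) = n * p := by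
    intro Q
    rw [Q.card_eq_index_normalizer, Subgroup.index_mul_card, hG]
  have hcN : ∀ Q, Nat.card (Sylow p G) * c Q ≤ n := by
    intro Q
    refine Nat.le_of_mul_le_mul_right ?_ hp.out.pos
    rw [← hN Q, mul_assoc, ← hc Q]
    exact Nat.mul_le_mul_left _ (Nat.card_le_card_of_injective _
      (Subgroup.inclusion_injective (hCN Q)))
  have hsum : n ≤ ∑ Q, c Q := by
    refine Nat.le_of_mul_le_mul_right ?_ hp1
    rw [Finset.sum_mul]
    exact hsing.trans ((card_dvd_orderOf_le_sum hG hn).trans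
      (Finset.sum_le_sum fun Q _ => hcle Q))
  have heq : Nat.card (Sylow p G) * c P = n := by
    by_contra hne
    have hlt : ∑ Q, Nat.card (Sylow p G) * c Q < ∑ Q : Sylow p G, n :=
      Finset.sum_lt_sum (fun Q _ => hcN Q) ⟨P, Finset.mem_univ P, lt_of_le_of_ne (hcN P) hne⟩
    rw [← Finset.mul_sum, Finset.sum_const, Finset.card_univ, ← Nat.card_eq_fintype_card,
      smul_eq_mul] at hlt
    exact absurd (Nat.lt_of_mul_lt_mul_left hlt) (not_lt.2 hsum)
  have hcard : Nat.card (Subgroup.normalizer (P : Set G)) ≤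
      Nat.card (Subgroup.centralizer (P : Set G)) := by
    refine Nat.le_of_mul_le_mul_left (c := Nat.card (Sylow p G)) ?_ Nat.card_pos
    rw [hN P, hc P, ← mul_assoc, heq]
  exact (Subgroup.eq_of_le_of_card_ge (hCN P) hcard).ge

theorem exists_mulEquiv_prod_of_card_dvd_orderOf (hp : p.Prime) (hp5 : 5 < p)
    (hG : Nat.card G = 60 * p) (hsing : 60 * (p - 1) ≤ Nat.card {g : G // p ∣ orderOf g}) :
    ∃ K : Subgroup G, Nat.card K = 60 ∧ Nonempty (G ≃* K × Multiplicative (ZMod p)) := by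
  have := Fact.mk hp
  have hn := not_dvd_sixty hp hp5
  obtain ⟨P⟩ : Nonempty (Sylow p G) := inferInstance
  have hPc := P.card_eq_prime hG hn
  -- Burnside's transfer theorem: the kernel is a normal complement of `P`.
  have hcompl := MonoidHom.ker_transferSylow_isComplement' P
    (normalizer_le_centralizer_of_card_dvd_orderOf hG hn hsing P)
  set K := (MonoidHom.transferSylow P
    (normalizer_le_centralizer_of_card_dvd_orderOf hG hn hsing P)).ker with hKdef
  have hKc : Nat.card K = 60 := by
    have h := hcompl.card_mul_card
    rw [hG, hPc] at h
    exact Nat.eq_of_mul_eq_mul_right hp.pos h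
  refine ⟨K, hKc, ?_⟩
  have hcomm : ∀ (k : K) (z : (P : Subgroup G)), Commute (k : G) (z : G) := by
    intro k z
    have hz : z ^ p = 1 := by
      have := pow_card_eq_one' (x := z)
      rwa [hPc] at this
    have h1 : (MulAut.conjNormal (H := K) (z : G)) ^ p = 1 := by
      rw [← map_pow]
      have : (z : G) ^ p = 1 := congrArg Subtype.val hz
      rw [this, map_one]
    have h2 := MulAut.eq_one_of_card_sixty hKc hp hp5 h1
    have h3 : (z : G) * k * (z : G)⁻¹ = k := by
      rw [← MulAut.conjNormal_apply, h2]
      rfl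
    exact (mul_inv_eq_iff_eq_mul.1 h3).symm
  have hbij : Function.Bijective
      (MonoidHom.noncommCoprod K.subtype (P : Subgroup G).subtype hcomm) :=
    hcompl
  have e2 : (P : Subgroup G) ≃* Multiplicative (ZMod p) :=
    mulEquivOfPrimeCardEq (p := p) hPc (by
      rw [Nat.card_congr Multiplicative.toAdd, Nat.card_zmod])
  exact ⟨(MulEquiv.ofBijective _ hbij).symm.trans ((MulEquiv.refl K).prodCongr e2)⟩

end CentralSylow

/-! ### `Exp_ρ` of products, and `|G|` recovered from `Exp_ρ(G)` -/

theorem prodElementOrders_congr {G H : Type*} [Group G] [Group H] (e : G ≃* H) :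
    prodElementOrders G = prodElementOrders H :=
  finprod_eq_of_bijective e e.bijective fun x => (e.orderOf_eq x).symm

theorem primeFactors_prodElementOrders (G : Type*) [Group G] [Finite G] :
    (prodElementOrders G).primeFactors = (Nat.card G).primeFactors := by
  have := Fintype.ofFinite G
  ext q
  by_cases hq : q.Prime
  swap
  · simp [hq]
  have hne : prodElementOrders G ≠ 0 := by
    rw [prodElementOrders_eq_prod]
    exact Finset.prod_ne_zero_iff.2 fun g _ => (orderOf_pos g).ne'
  rw [Nat.mem_primeFactors_of_ne_zero hne, Nat.mem_primeFactors_of_ne_zero Nat.card_pos.ne',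
    and_iff_right hq, and_iff_right hq]
  refine ⟨fun h => ?_, fun h => ?_⟩
  · rw [prodElementOrders_eq_prod, hq.prime.dvd_finsetProd_iff] at h
    obtain ⟨g, -, hg⟩ := h
    exact hg.trans (orderOf_dvd_natCard g)
  · exact Nat.dvd_of_factorization_pos (factorization_prodElementOrders_pos hq h).ne'

theorem expRho_eq_image (G : Type*) [Group G] [Finite G] :
    expRho G = (Nat.card G).primeFactors.image fun q => (prodElementOrders G).factorization q := by
  rw [expRho, exponentSet, primeFactors_prodElementOrders]

theorem prodElementOrders_prod_factorization {K Z : Type*} [Group K] [Group Z] [Finite K]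
    [Finite Z] {q : ℕ} (hq : ¬ q ∣ Nat.card Z) :
    (prodElementOrders (K × Z)).factorization q =
      Nat.card Z * (prodElementOrders K).factorization q := by
  have := Fintype.ofFinite K
  have := Fintype.ofFinite Z
  rw [prodElementOrders_factorization, prodElementOrders_factorization, Fintype.sum_prod_type,
    Finset.mul_sum]
  refine Finset.sum_congr rfl fun k _ => ?_
  have h : ∀ z : Z, (orderOf (k, z)).factorization q = (orderOf k).factorization q := by
    intro z
    rw [Prod.orderOf_mk, Nat.factorization_lcm (orderOf_pos k).ne' (orderOf_pos z).ne',
      Finsupp.sup_apply,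
      Nat.factorization_eq_zero_of_not_dvd fun h => hq (h.trans (orderOf_dvd_natCard z))]
    exact Nat.max_zero _
  rw [Finset.sum_congr rfl fun z _ => h z, Finset.sum_const, Finset.card_univ,
    ← Nat.card_eq_fintype_card, smul_eq_mul]

theorem prodElementOrders_prime_card {p : ℕ} (hp : p.Prime) {Z : Type*} [Group Z] [Finite Z]
    (hZ : Nat.card Z = p) : (prodElementOrders Z).factorization p = p - 1 := by
  classical
  have := Fintype.ofFinite Z
  rw [prodElementOrders_factorization, ← Finset.sum_erase Finset.univ (a := (1 : Z)) (by simp),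
    Finset.sum_congr rfl (g := fun _ => 1), Finset.sum_const,
    Finset.card_erase_of_mem (Finset.mem_univ _), Finset.card_univ, ← Nat.card_eq_fintype_card,
    hZ, smul_eq_mul, mul_one]
  intro z hz
  have h : orderOf z ∣ p := hZ ▸ orderOf_dvd_natCard z
  rcases (Nat.dvd_prime hp).1 h with h | h
  · exact absurd (orderOf_eq_one_iff.1 h) (Finset.ne_of_mem_erase hz)
  · rw [h, hp.factorization_self]

/-- `d` divides 60p - 60(p-1) = 60 = `s * t`, hence gcd(`s * p`, `s * t`) = `s`. -/
theorem dvd_of_dvd_mul_of_dvd_sixty_mul {p d s t : ℕ} (hp : p.Prime) (hst : s * t = 60)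
    (hpt : ¬ p ∣ t) (h1 : d ∣ s * p) (h2 : d ∣ 60 * (p - 1)) : d ∣ s := by
  have h3 : d ∣ 60 := by
    have h4 : d ∣ 60 * p := hst ▸ h1.trans ⟨t, by ring⟩
    have h5 : 60 = 60 * p - 60 * (p - 1) := by
      rw [Nat.mul_sub_one]
      have := hp.pos
      omega
    rw [h5]
    exact Nat.dvd_sub h4 h2
  have h6 : d ∣ Nat.gcd (s * p) (s * t) := Nat.dvd_gcd h1 (hst ▸ h3)
  rwa [Nat.gcd_mul_left, (Nat.Prime.coprime_iff_not_dvd hp).2 hpt, mul_one] at h6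

theorem prodElementOrders_factorization_eq_card_dvd_orderOf {G : Type*} [Group G] [Finite G] {p : ℕ}
    (hp : p.Prime) (h : (Nat.card G).factorization p = 1) :
    (prodElementOrders G).factorization p = Nat.card {g : G // p ∣ orderOf g} := by
  classical
  have := Fintype.ofFinite G
  rw [prodElementOrders_factorization, Nat.card_eq_fintype_card, Fintype.card_subtype,
    Finset.card_filter]
  refine Finset.sum_congr rfl fun g _ => ?_
  split_ifs with hg
  · have h1 := (Nat.factorization_le_iff_dvd (orderOf_pos g).ne' Nat.card_pos.ne').2
      (orderOf_dvd_natCard g) p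
    have h2 := hp.factorization_pos_of_dvd (orderOf_pos g).ne' hg
    omega
  · exact Nat.factorization_eq_zero_of_not_dvd hg

theorem card_and_factorizations_of_expRho_eq {G : Type*} [Group G] [Finite G] {p : ℕ}
    (hp : p.Prime) (hp5 : 5 < p)
    (h : expRho G = {15 * p, 20 * p, 24 * p, 60 * (p - 1)}) :
    Nat.card G = 60 * p ∧ (prodElementOrders G).factorization 2 = 15 * p ∧
      (prodElementOrders G).factorization 3 = 20 * p ∧
      (prodElementOrders G).factorization 5 = 24 * p ∧
      (prodElementOrders G).factorization p = 60 * (p - 1) := by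
  rw [expRho_eq_image] at h
  set α := fun q => (prodElementOrders G).factorization q with hα
  have hn0 : Nat.card G ≠ 0 := Nat.card_pos.ne'
  have hp60 := not_dvd_sixty hp hp5
  have hex : ∀ v ∈ ({15 * p, 20 * p, 24 * p, 60 * (p - 1)} : Finset ℕ),
      ∃ q, q.Prime ∧ q ∣ Nat.card G ∧ α q = v := by
    intro v hv
    rw [← h, Finset.mem_image] at hv
    obtain ⟨q, hq, hqv⟩ := hv
    exact ⟨q, Nat.prime_of_mem_primeFactors hq, Nat.dvd_of_mem_primeFactors hq, hqv⟩
  obtain ⟨a, ha, han, hav⟩ := hex (15 * p) (by simp)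
  obtain ⟨b, hb, hbn, hbv⟩ := hex (20 * p) (by simp)
  obtain ⟨c, hc, hcn, hcv⟩ := hex (24 * p) (by simp)
  obtain ⟨d, hd, hdn, hdv⟩ := hex (60 * (p - 1)) (by simp)
  have hab : a ≠ b := by rintro rfl; omega
  have hac : a ≠ c := by rintro rfl; omega
  have had : a ≠ d := by rintro rfl; omega
  have hbc : b ≠ c := by rintro rfl; omega
  have hbd : b ≠ d := by rintro rfl; omega
  have hcd : c ≠ d := by rintro rfl; omega
  let D := fun r => r ^ (Nat.card G).factorization r
  have hD : ∀ r q, r.Prime → q.Prime → r ≠ q → D r ∣ α q := fun r q hr hq hrq =>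
    ordProj_dvd_prodElementOrders_factorization G hr hq hrq
  have hself : ∀ r, r.Prime → r ∣ Nat.card G → r ∣ D r := fun r hr hrn =>
    dvd_pow_self r (hr.factorization_pos_of_dvd hn0 hrn).ne'
  -- Integer combinations of the listed values give 4p, 3p, 5p and p; the value 60(p-1) then removes
  -- the factor p in the first three cases.
  have d4 : ∀ e, e ∣ 20 * p → e ∣ 24 * p → e ∣ 60 * (p - 1) → e ∣ 4 := by
    intro e h1 h2 h3
    refine dvd_of_dvd_mul_of_dvd_sixty_mul (t := 15) hp (by norm_num)
      (fun h => hp60 (h.trans (by norm_num))) ?_ h3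
    rw [show 4 * p = 24 * p - 20 * p by omega]
    exact Nat.dvd_sub h2 h1
  have d3 : ∀ e, e ∣ 15 * p → e ∣ 24 * p → e ∣ 60 * (p - 1) → e ∣ 3 := by
    intro e h1 h2 h3
    refine dvd_of_dvd_mul_of_dvd_sixty_mul (t := 20) hp (by norm_num)
      (fun h => hp60 (h.trans (by norm_num))) ?_ h3
    rw [show 3 * p = 2 * (24 * p) - 3 * (15 * p) by omega]
    exact Nat.dvd_sub (h2.mul_left 2) (h1.mul_left 3)
  have d5 : ∀ e, e ∣ 15 * p → e ∣ 20 * p → e ∣ 60 * (p - 1) → e ∣ 5 := by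
    intro e h1 h2 h3
    refine dvd_of_dvd_mul_of_dvd_sixty_mul (t := 12) hp (by norm_num)
      (fun h => hp60 (h.trans (by norm_num))) ?_ h3
    rw [show 5 * p = 20 * p - 15 * p by omega]
    exact Nat.dvd_sub h2 h1
  have dp : ∀ e, e ∣ 15 * p → e ∣ 20 * p → e ∣ 24 * p → e ∣ p := by
    intro e h1 h2 h3
    rw [show p = (20 * p - 15 * p) - (24 * p - 20 * p) by omega]
    exact Nat.dvd_sub (Nat.dvd_sub h2 h1) (Nat.dvd_sub h3 h2)
  have hDa : D a ∣ 4 := d4 _ (hbv ▸ hD a b ha hb hab) (hcv ▸ hD a c ha hc hac)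
    (hdv ▸ hD a d ha hd had)
  have hDb : D b ∣ 3 := d3 _ (hav ▸ hD b a hb ha hab.symm) (hcv ▸ hD b c hb hc hbc)
    (hdv ▸ hD b d hb hd hbd)
  have hDc : D c ∣ 5 := d5 _ (hav ▸ hD c a hc ha hac.symm) (hbv ▸ hD c b hc hb hbc.symm)
    (hdv ▸ hD c d hc hd hcd)
  have hDd : D d ∣ p := dp _ (hav ▸ hD d a hd ha had.symm) (hbv ▸ hD d b hd hb hbd.symm)
    (hcv ▸ hD d c hd hc hcd.symm)
  have hother : ∀ r, r.Prime → r ∣ Nat.card G → r = a ∨ r = b ∨ r = c ∨ r = d := by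
    intro r hr hrn
    by_contra! hne
    obtain ⟨hra, hrb, hrc, hrd⟩ := hne
    have h1 := hav ▸ hD r a hr ha hra
    have h2 := hbv ▸ hD r b hr hb hrb
    have h3 := hcv ▸ hD r c hr hc hrc
    have h4 := hdv ▸ hD r d hr hd hrd
    have h5 : r ∣ Nat.gcd 4 3 :=
      (hself r hr hrn).trans (Nat.dvd_gcd (d4 _ h2 h3 h4) (d3 _ h1 h3 h4))
    exact hr.one_lt.ne' (Nat.dvd_one.1 h5)
  have ea : a = 2 := by
    refine (Nat.prime_dvd_prime_iff_eq ha Nat.prime_two).1 (ha.dvd_of_dvd_pow (n := 2) ?_)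
    exact (hself a ha han).trans hDa
  have eb : b = 3 := (Nat.prime_dvd_prime_iff_eq hb Nat.prime_three).1 ((hself b hb hbn).trans hDb)
  have ec : c = 5 := (Nat.prime_dvd_prime_iff_eq hc Nat.prime_five).1 ((hself c hc hcn).trans hDc)
  have ed : d = p := (Nat.prime_dvd_prime_iff_eq hd hp).1 ((hself d hd hdn).trans hDd)
  subst ea eb ec ed
  have hD3 : D 3 = 3 := Nat.dvd_antisymm hDb (hself 3 hb hbn)
  have hD5 : D 5 = 5 := Nat.dvd_antisymm hDc (hself 5 hc hcn)
  have hDp : D d = d := Nat.dvd_antisymm hDd (hself d hd hdn)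
  have hpf : (Nat.card G).primeFactors = {2, 3, 5, d} := by
    ext r
    simp only [Nat.mem_primeFactors, Finset.mem_insert, Finset.mem_singleton]
    refine ⟨fun hr => hother r hr.1 hr.2.1, ?_⟩
    rintro (rfl | rfl | rfl | rfl)
    exacts [⟨ha, han, hn0⟩, ⟨hb, hbn, hn0⟩, ⟨hc, hcn, hn0⟩, ⟨hd, hdn, hn0⟩]
  have hcard : Nat.card G = D 2 * (3 * (5 * d)) := by
    conv_lhs => rw [← Nat.prod_factorization_pow_eq_self hn0]
    rw [Nat.prod_factorization_eq_prod_primeFactors, hpf,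
      Finset.prod_insert (by simp [had]), Finset.prod_insert (by simp [hbd]),
      Finset.prod_insert (by simp [hcd]), Finset.prod_singleton]
    change D 2 * (D 3 * (D 5 * D d)) = _
    rw [hD3, hD5, hDp]
  have hv : (Nat.card G).factorization d = 1 :=
    Nat.pow_right_injective hd.two_le (hDp.trans (pow_one d).symm)
  -- `d` now stands for p. A 2-part equal to 2 would give `|G| = 30d`, too small for 60(d-1)
  -- elements of order divisible by `d`.
  have hle : 60 * (d - 1) ≤ Nat.card G := by
    rw [← hdv, hα]
    change (prodElementOrders G).factorization d ≤ _
    rw [prodElementOrders_factorization_eq_card_dvd_orderOf hd hv]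
    exact Nat.card_le_card_of_injective _ Subtype.val_injective
  have hD2 : D 2 = 4 := by
    have h2 := hself 2 ha han
    have h4 : D 2 ≤ 4 := Nat.le_of_dvd (by norm_num) hDa
    have hne : D 2 ≠ 2 := by
      intro h2
      rw [hcard, h2] at hle
      omega
    have h0 : D 2 ≠ 0 := fun h0 => by rw [h0] at hDa; omega
    omega
  exact ⟨by rw [hcard, hD2]; ring, hav, hbv, hcv, hdv⟩

/-! ### The characterization -/

theorem mainTheorem1 (p : ℕ) (hp : p.Prime) (hp5 : 5 < p) :
    expRho (Matrix.ProjectiveSpecialLinearGroup (Fin 2) (ZMod 5) × Multiplicative (ZMod p)) =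
        {15 * p, 20 * p, 24 * p, 60 * (p - 1)} ∧
      ∀ (G : Type*) [Group G] [Finite G],
        Nonempty (G ≃*
            Matrix.ProjectiveSpecialLinearGroup (Fin 2) (ZMod 5) × Multiplicative (ZMod p)) ↔
          expRho G =
            expRho
              (Matrix.ProjectiveSpecialLinearGroup (Fin 2) (ZMod 5) × Multiplicative (ZMod p)) :=
  by
  have := Fact.mk hp
  have hp60 := not_dvd_sixty hp hp5
  have hS := card_projectiveSpecialLinearGroup_two_five
  set S := Matrix.ProjectiveSpecialLinearGroup (Fin 2) (ZMod 5)
  have hSf : Finite S := Nat.finite_of_card_ne_zero (by rw [hS]; norm_num)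
  have hZ : Nat.card (Multiplicative (ZMod p)) = p := by
    rw [Nat.card_congr Multiplicative.toAdd, Nat.card_zmod]
  have hZf : Finite (Multiplicative (ZMod p)) :=
    Nat.finite_of_card_ne_zero (by rw [hZ]; exact hp.ne_zero)
  have hndvd : ∀ q, q ∣ 60 → q ≠ 1 → ¬ q ∣ Nat.card (Multiplicative (ZMod p)) := by
    intro q hq hq1 h
    rw [hZ] at h
    exact hp60 (((Nat.dvd_prime hp).1 h).resolve_left hq1 ▸ hq)
  have hfac := factorizations_of_orderOf_prime hS orderOf_prime_projectiveSpecialLinearGroup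
  have hexp : expRho (S × Multiplicative (ZMod p)) =
      {15 * p, 20 * p, 24 * p, 60 * (p - 1)} := by
    have hpf : (Nat.card (S × Multiplicative (ZMod p))).primeFactors = {2, 3, 5, p} := by
      rw [Nat.card_prod, hS, hZ, Nat.primeFactors_mul (by norm_num) hp.ne_zero,
        hp.primeFactors, show 60 = 2 ^ 2 * 3 * 5 by norm_num,
        Nat.primeFactors_mul (by norm_num) (by norm_num),
        Nat.primeFactors_mul (by norm_num) (by norm_num),
        Nat.primeFactors_prime_pow (by norm_num) Nat.prime_two, Nat.prime_three.primeFactors,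
        Nat.prime_five.primeFactors]
      ext x
      simp
    have hpp : (prodElementOrders (S × Multiplicative (ZMod p))).factorization p =
        60 * (p - 1) := by
      -- The factors are swapped so that the one of order prime to `p` stands second.
      rw [prodElementOrders_congr (MulEquiv.prodComm (M := S) (N := Multiplicative (ZMod p))),
        prodElementOrders_prod_factorization (hS.symm ▸ hp60), hS,
        prodElementOrders_prime_card hp hZ]
    rw [expRho_eq_image, hpf]
    simp only [Finset.image_insert, Finset.image_singleton, hpp]
    rw [prodElementOrders_prod_factorization (hndvd 2 (by norm_num) (by norm_num)),
      prodElementOrders_prod_factorization (hndvd 3 (by norm_num) (by norm_num)),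
      prodElementOrders_prod_factorization (hndvd 5 (by norm_num) (by norm_num)),
      hfac.1, hfac.2.1, hfac.2.2, hZ, mul_comm p, mul_comm p, mul_comm p]
  refine ⟨hexp, fun G _ _ => ⟨fun ⟨e⟩ => ?_, fun h => ?_⟩⟩
  · rw [expRho, expRho, prodElementOrders_congr e]
  · rw [hexp] at h
    obtain ⟨hG, h2, h3, h5, hpG⟩ := card_and_factorizations_of_expRho_eq hp hp5 h
    obtain ⟨K, hK, ⟨e⟩⟩ := exists_mulEquiv_prod_of_card_dvd_orderOf hp hp5 hG (by
      rw [← hpG, prodElementOrders_factorization_eq_card_dvd_orderOf hp]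
      rw [hG, factorization_mul_self_of_not_dvd hp hp60])
    rw [prodElementOrders_congr e,
      prodElementOrders_prod_factorization (hndvd _ (by norm_num) (by norm_num)), hZ, mul_comm,
      Nat.mul_left_inj hp.ne_zero] at h2 h3 h5
    obtain ⟨eK⟩ := nonempty_mulEquiv_alternatingGroup_five hK
      fun x hx => orderOf_prime_of_factorizations hK h2 h3 h5 hx
    obtain ⟨eS⟩ := nonempty_mulEquiv_alternatingGroup_five hS
      orderOf_prime_projectiveSpecialLinearGroup
    exact ⟨e.trans ((eK.trans eS.symm).prodCongr (MulEquiv.refl _))⟩
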